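/- Let $B_n(x)$ and $E_n(x)$ be the Bernoulli and Euler polynomials, given by $\frac{te^{xt}}{e^t-1}=\sum_{n\ge0}B_n(x)\frac{t^n}{n!}$ and $\frac{2e^{xt}}{e^t+1}=\sum_{n\ge0}E_n(x)\frac{t^n}{n!}$. For real $x$ with fractional part $\{x\}$ and integer part $[x]$, let $\mathfrak B_n(x)=B_n(\{x\})$ if $n\neq1$ or $x\notin\mathbb Z$, let $\mathfrak B_1(x)=0$ for $x\in\mathbb Z$, and let $\mathcal E_n(x)=(-1)^{[x]}E_n(\{x\})$. For a Dirichlet character $\chi$ of odd modulus $k$ put \[ \mathfrak B_{m,\chi}(x)=k^{m-1}\sum_{j=0}^{k-1}\bar\chi(j)\,\mathfrak B_m\Big(\frac{j+x}{k}\Big)\quad(m\ge1),\qquad \mathcal E_{m,\chi}(x)=k^{m}\sum_{j=0}^{k-1}(-1)^j\bar\chi(j)\,\mathcal E_m\Big(\frac{j+x}{k}\Big)\quad(m\ge0). \] Let $\chi$ be the primitive character modulo $3$, so that $\chi(n)=1,-1,0$ according as $n\equiv1,2,0\pmod 3$. Then for every odd $p\ge1$ \[ \sum_{n=1}^{\infty}(-1)^{n(p+1)/2}\frac{\chi(n)}{n^p\left(2\cosh(n\pi/3)-(-1)^n\right)}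 =\frac{(-1)^{(p+1)/2}}{4\sqrt3}\,\frac{3}{p!}\Big(\frac{\pi}{3}\Big)^p\sum_{m=1}^{p}\binom pm i^{\,p-m}\,\mathcal E_{p-m,\chi}(0)\,\mathfrak B_{m,\chi}(0). \] In particular, \[ \sum_{n=1}^{\infty}\frac{(-1)^n\chi(n)}{n\left(2\cosh(n\pi/3)-(-1)^n\right)}=-\frac{\pi}{4\sqrt3}\,\mathcal E_{0,\chi}(0)\,\mathfrak B_{1,\chi}(0)=-\frac{\pi}{6\sqrt3} \] and \[ \sum_{n=1}^{\infty}\frac{\chi(n)}{n^3\left(2\cosh(n\pi/3)-(-1)^n\right)}=\frac{(\pi/3)^3}{8\sqrt3}\Big(\mathcal E_{0,\chi}(0)\,\mathfrak B_{3,\chi}(0)-3\,\mathcal E_{2,\chi}(0)\,\mathfrak B_{1,\chi}(0)\Big). \] All three series converge absolutely. -/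

import Mathlib

open scoped Nat

noncomputable section

/-- The Euler polynomial `E_n(x)`: `n!` times the coefficient of `t ^ n` in
`2 e ^ (x t) / (e ^ t + 1)`. The power series `e ^ t + 1` has constant coefficient `2`, so its
inverse is genuine. -/
def eulerPoly (n : ℕ) (x : ℝ) : ℝ :=
  (n ! : ℝ) * PowerSeries.coeff n
    (2 * PowerSeries.rescale x (PowerSeries.exp ℝ) * (PowerSeries.exp ℝ + 1)⁻¹)

/-- The generating function identity `∑ E_n(x) t ^ n / n! = 2 e ^ (x t) / (e ^ t + 1)`, with the
denominator cleared. -/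
theorem eulerPoly_generating (x : ℝ) :
    PowerSeries.mk (fun n => eulerPoly n x / (n ! : ℝ)) * (PowerSeries.exp ℝ + 1) =
      2 * PowerSeries.rescale x (PowerSeries.exp ℝ) := by
  have h : PowerSeries.mk (fun n => eulerPoly n x / (n ! : ℝ)) =
      2 * PowerSeries.rescale x (PowerSeries.exp ℝ) * (PowerSeries.exp ℝ + 1)⁻¹ := by
    ext n
    have hn : (n ! : ℝ) ≠ 0 := by exact_mod_cast n.factorial_ne_zero
    rw [PowerSeries.coeff_mk, eulerPoly, mul_div_cancel_left₀ _ hn]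
  have hc : PowerSeries.constantCoeff (PowerSeries.exp ℝ + 1) ≠ 0 := by
    simp
  rw [h, mul_assoc, PowerSeries.inv_mul_cancel _ hc, mul_one]

/-- The Bernoulli function `𝔅_n(x)`: it has period `1`, equals the Bernoulli polynomial `B_n(x)`
for `0 ≤ x < 1`, except that `𝔅_1` vanishes at the integers. -/
def bernoulliPer (n : ℕ) (x : ℝ) : ℝ :=
  if n = 1 ∧ Int.fract x = 0 then 0 else bernoulliFun n (Int.fract x)

/-- The Euler function `𝓔_n(x)`: `𝓔_n(x) = E_n(x)` for `0 ≤ x < 1` and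
`𝓔_n(x + m) = (-1) ^ m 𝓔_n(x)` for integers `m`. -/
def eulerPer (n : ℕ) (x : ℝ) : ℝ :=
  (-1 : ℝ) ^ ⌊x⌋ * eulerPoly n (Int.fract x)

/-- The generalized Bernoulli function `𝔅_{m,χ}(x)` (for `m ≥ 1`). -/
def bernoulliChar {k : ℕ} (χ : DirichletCharacter ℂ k) (m : ℕ) (x : ℝ) : ℂ :=
  (k : ℂ) ^ ((m : ℤ) - 1) *
    ∑ j ∈ Finset.range k,
      (starRingEnd ℂ) (χ (j : ZMod k)) * (bernoulliPer m (((j : ℝ) + x) / (k : ℝ)) : ℂ)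

/-- The character Euler function `𝓔_{m,χ}(x)` (for odd modulus `k`). -/
def eulerChar {k : ℕ} (χ : DirichletCharacter ℂ k) (m : ℕ) (x : ℝ) : ℂ :=
  (k : ℂ) ^ m *
    ∑ j ∈ Finset.range k,
      (-1 : ℂ) ^ j * (starRingEnd ℂ) (χ (j : ZMod k)) *
        (eulerPer m (((j : ℝ) + x) / (k : ℝ)) : ℂ)

/-- The integer-valued character modulo `3` with values `0, 1, -1` at `0, 1, 2`. -/
def chiThreeInt : MulChar (ZMod 3) ℤ where
  toFun a :=
    match a with
    | 0 => 0
    | 1 => 1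
    | 2 => -1
  map_one' := rfl
  map_mul' := by decide
  map_nonunit' := by decide

/-- The real primitive Dirichlet character modulo `3`. -/
def chiThree : DirichletCharacter ℂ 3 :=
  chiThreeInt.ringHomComp (Int.castRingHom ℂ)

theorem chiThree_apply (n : ℤ) :
    chiThree (n : ZMod 3) = if n % 3 = 1 then 1 else if n % 3 = 2 then -1 else 0 := by
  have h : ∀ a : ZMod 3, chiThreeInt a = if a = 1 then 1 else if a = 2 then -1 else 0 := by
    decide
  have h1 : ((n : ZMod 3) = 1) ↔ n % 3 = 1 := by
    have := ZMod.intCast_eq_intCast_iff' n 1 3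
    simpa using this
  have h2 : ((n : ZMod 3) = 2) ↔ n % 3 = 2 := by
    have := ZMod.intCast_eq_intCast_iff' n 2 3
    simpa using this
  simp only [chiThree, MulChar.ringHomComp_apply, h, h1, h2]
  split_ifs <;> simp

theorem chiThree_isPrimitive : chiThree.IsPrimitive := by
  have hd : chiThree.conductor ∣ 3 := chiThree.conductor_dvd_level
  rcases (Nat.dvd_prime Nat.prime_three).1 hd with h | h
  · exfalso
    have h1 : chiThree = 1 := (DirichletCharacter.eq_one_iff_conductor_eq_one).2 h
    have h2 := chiThree_apply 2
    have h3 : IsUnit ((2 : ℤ) : ZMod 3) := by decide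
    rw [h1, MulChar.one_apply h3] at h2
    norm_num at h2
  · exact h

end

noncomputable section

open Filter Topology Finset

/-! Both sides come from the Taylor coefficients of `1 / ((2 cosh z + 1) (2 cos z - 1))` at `z = π w
/ 3`.

Finite side: the exponential generating functions of the Bernoulli and Euler numbers of `χ` are `-z
/ (2 cosh z + 1)` and `-2 / (2 cosh z - 1)`. Replacing `z` by `i z` in the second and multiplying
gives `2 z` over the product above, and the Cauchy product is the binomial sum.

Infinite side: up to the factor `π √3 / 6`, `1 / (2 cos (π w / 3) ∓ 1)` equals `∑ ε_a(n) n / (n² -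
w²)` with `ε_a = oddSign a`, `a = 1, 2`. Multiply the expansion for `a = 1` at `w` by that for `a =
2` at `i w`, and split each term by `1 / ((n² - w²)(k² + w²)) = (1 / (n² - w²) + 1 / (k² + w²)) /
(n² + k²)`. The inner sums are the same expansions at `i n` and `i k`, hence multiples of `1 / (2
cosh (n π / 3) - (-1) ^ n)`. Since `χ = ε_1 - ε_2`, expanding in powers of `w` yields the series of
the theorem.

The partial fractions converge only conditionally, so the product is taken over square truncations;
the uniform bound `norm_cosPartialFrac_le` permits dominated convergence
(`cosPartialFracLim_mul_cosPartialFracLim`). `HasSumOnUnitDisc.unique` turns the analytic identity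
into one of power series. -/

/-! ### Generating functions of the character Bernoulli and Euler numbers -/

theorem chiThree_natCast_zero : chiThree ((0 : ℕ) : ZMod 3) = 0 := by
  simpa using chiThree_apply 0

theorem chiThree_natCast_one : chiThree ((1 : ℕ) : ZMod 3) = 1 := by
  simp

theorem chiThree_natCast_two : chiThree ((2 : ℕ) : ZMod 3) = -1 := by
  simpa using chiThree_apply 2

theorem bernoulliChar_chiThree (m : ℕ) :
    bernoulliChar chiThree m 0 =
      (((3 : ℝ) ^ ((m : ℤ) - 1) * (bernoulliFun m (1 / 3) - bernoulliFun m (2 / 3)) : ℝ) : ℂ) := by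
  have h1 : Int.fract (1 / 3 : ℝ) = 1 / 3 := Int.fract_eq_self.2 ⟨by norm_num, by norm_num⟩
  have h2 : Int.fract (2 / 3 : ℝ) = 2 / 3 := Int.fract_eq_self.2 ⟨by norm_num, by norm_num⟩
  simp only [bernoulliChar, Finset.sum_range_succ, Finset.sum_range_zero, chiThree_natCast_zero,
    chiThree_natCast_one, chiThree_natCast_two, bernoulliPer]
  norm_num [h1, h2]
  left; ring

theorem eulerChar_chiThree (m : ℕ) :
    eulerChar chiThree m 0 =
      (((3 : ℝ) ^ m * (-eulerPoly m (1 / 3) - eulerPoly m (2 / 3)) : ℝ) : ℂ) := by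
  have h1 : Int.fract (1 / 3 : ℝ) = 1 / 3 := Int.fract_eq_self.2 ⟨by norm_num, by norm_num⟩
  have h2 : Int.fract (2 / 3 : ℝ) = 2 / 3 := Int.fract_eq_self.2 ⟨by norm_num, by norm_num⟩
  have h3 : ⌊(1 / 3 : ℝ)⌋ = 0 := Int.floor_eq_iff.2 ⟨by norm_num, by norm_num⟩
  have h4 : ⌊(2 / 3 : ℝ)⌋ = 0 := Int.floor_eq_iff.2 ⟨by norm_num, by norm_num⟩
  simp only [eulerChar, Finset.sum_range_succ, Finset.sum_range_zero, chiThree_natCast_zero,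
    chiThree_natCast_one, chiThree_natCast_two, eulerPer]
  norm_num [h1, h2, h3, h4]
  ring

namespace PowerSeries

theorem mk_bernoulliFun_mul (t : ℝ) :
    mk (fun n => bernoulliFun n t / (n ! : ℝ)) * (exp ℝ - 1) = X * rescale t (exp ℝ) := by
  rw [← Polynomial.bernoulli_generating_function t]
  congr 2
  ext n
  simp [bernoulliFun, Polynomial.aeval_def, Polynomial.eval_map, div_eq_inv_mul,
    Algebra.smul_def]

theorem rescale_natCast_exp {A : Type*} [CommRing A] [Algebra ℚ A] (n : ℕ) :
    rescale (n : A) (exp A) = exp A ^ n :=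
  (exp_pow_eq_rescale_exp n).symm

theorem exp_mul_rescale_neg_one {A : Type*} [CommRing A] [Algebra ℚ A] :
    exp A * rescale (-1 : A) (exp A) = 1 := by
  simpa [evalNegHom] using exp_mul_exp_neg_eq_one (A := A)

/-- After `t ↦ 3 t` the numerator contains `e^t - e^(2t)`, whose factor `e^t - 1` cancels against
`e^(3t) - 1`. Multiplying by `e^(-t)` makes the remaining denominator symmetric. -/
theorem mk_bernoulliChar_real_mul :
    (mk fun m => (3 : ℝ) ^ ((m : ℤ) - 1) * (bernoulliFun m (1 / 3) - bernoulliFun m (2 / 3)) /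
        (m ! : ℝ)) * (exp ℝ + rescale (-1 : ℝ) (exp ℝ) + 1) = -X := by
  set F := mk fun m => (3 : ℝ) ^ ((m : ℤ) - 1) *
    (bernoulliFun m (1 / 3) - bernoulliFun m (2 / 3)) / (m ! : ℝ) with hF
  have hF' : 3 * F = rescale (3 : ℝ) (mk (fun n => bernoulliFun n (1 / 3) / (n ! : ℝ))) -
      rescale (3 : ℝ) (mk (fun n => bernoulliFun n (2 / 3) / (n ! : ℝ))) := by
    ext n
    rw [show (3 : PowerSeries ℝ) = C (3 : ℝ) from (map_ofNat C 3).symm, coeff_C_mul]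
    simp only [hF, coeff_mk, map_sub, coeff_rescale, zpow_sub_one₀ (three_ne_zero' ℝ),
      zpow_natCast]
    ring
  have h3 : rescale (3 : ℝ) (exp ℝ) = exp ℝ ^ 3 := by exact_mod_cast rescale_natCast_exp (A := ℝ) 3
  have h2 : rescale (2 : ℝ) (exp ℝ) = exp ℝ ^ 2 := by exact_mod_cast rescale_natCast_exp (A := ℝ) 2
  have e1 := congrArg (rescale (3 : ℝ)) (mk_bernoulliFun_mul (1 / 3))
  have e2 := congrArg (rescale (3 : ℝ)) (mk_bernoulliFun_mul (2 / 3))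
  simp only [map_mul, map_sub, map_one, h3, rescale_X, rescale_rescale] at e1 e2
  norm_num at e1 e2
  rw [h2] at e2
  have hC : (C (3 : ℝ) : PowerSeries ℝ) = 3 := map_ofNat C 3
  simp only [hC] at e1 e2
  have hE : exp ℝ - 1 ≠ 0 := fun h => by
    have := congrArg (coeff 1) h
    simp [coeff_exp, coeff_one] at this
  have h30 : (3 : PowerSeries ℝ) ≠ 0 := by
    rw [← hC]
    exact (map_ne_zero_iff C C_injective).2 three_ne_zero
  have key : (3 * F) * (exp ℝ ^ 3 - 1) = 3 * X * (exp ℝ - exp ℝ ^ 2) := by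
    rw [hF', sub_mul, e1, e2]; ring
  have key2 : F * (exp ℝ ^ 2 + exp ℝ + 1) = -X * exp ℝ := by
    apply mul_left_cancel₀ hE
    apply mul_left_cancel₀ h30
    linear_combination key
  have hn := exp_mul_rescale_neg_one (A := ℝ)
  linear_combination rescale (-1 : ℝ) (exp ℝ) * key2 - (F * exp ℝ + F + X) * hn

/-- The signs `(-1) ^ j` give both terms the coefficient `-1`, so `e^t + e^(2t)` appears and `e^t +
1` cancels against `e^(3t) + 1`. -/
theorem mk_eulerChar_real_mul :
    (mk fun m => (3 : ℝ) ^ m * (-eulerPoly m (1 / 3) - eulerPoly m (2 / 3)) / (m ! : ℝ)) *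
      (exp ℝ + rescale (-1 : ℝ) (exp ℝ) - 1) = -2 := by
  set F := mk fun m => (3 : ℝ) ^ m * (-eulerPoly m (1 / 3) - eulerPoly m (2 / 3)) / (m ! : ℝ)
    with hF
  have hF' : F = -rescale (3 : ℝ) (mk (fun n => eulerPoly n (1 / 3) / (n ! : ℝ))) -
      rescale (3 : ℝ) (mk (fun n => eulerPoly n (2 / 3) / (n ! : ℝ))) := by
    ext n
    simp only [hF, coeff_mk, map_sub, map_neg, coeff_rescale]
    ring
  have h3 : rescale (3 : ℝ) (exp ℝ) = exp ℝ ^ 3 := by exact_mod_cast rescale_natCast_exp (A := ℝ) 3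
  have h2 : rescale (2 : ℝ) (exp ℝ) = exp ℝ ^ 2 := by exact_mod_cast rescale_natCast_exp (A := ℝ) 2
  have e1 := congrArg (rescale (3 : ℝ)) (eulerPoly_generating (1 / 3))
  have e2 := congrArg (rescale (3 : ℝ)) (eulerPoly_generating (2 / 3))
  simp only [map_mul, map_add, map_one, h3, rescale_rescale, map_ofNat] at e1 e2
  norm_num at e1 e2
  rw [h2] at e2
  have hE : exp ℝ + 1 ≠ 0 := fun h => by
    have := congrArg (coeff 1) h
    simp [coeff_exp, coeff_one] at this
  have key : F * (exp ℝ ^ 3 + 1) = -2 * (exp ℝ + exp ℝ ^ 2) := by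
    rw [hF', sub_mul, neg_mul, e1, e2]; ring
  have key2 : F * (exp ℝ ^ 2 - exp ℝ + 1) = -2 * exp ℝ := by
    apply mul_left_cancel₀ hE
    linear_combination key
  have hn := exp_mul_rescale_neg_one (A := ℝ)
  linear_combination rescale (-1 : ℝ) (exp ℝ) * key2 - (F * exp ℝ - F + 2) * hn

theorem map_rescale {R S : Type*} [CommSemiring R] [CommSemiring S] (f : R →+* S) (a : R)
    (P : PowerSeries R) : map f (rescale a P) = rescale (f a) (map f P) := by
  ext n; simp

theorem mk_bernoulliChar_mul :
    (mk fun m => bernoulliChar chiThree m 0 / (m ! : ℂ)) *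
      (exp ℂ + rescale (-1 : ℂ) (exp ℂ) + 1) = -X := by
  have h := congrArg (map Complex.ofRealHom) mk_bernoulliChar_real_mul
  simp only [map_mul, map_add, map_one, map_neg, map_X, map_exp, map_rescale] at h
  rw [← h]
  congr 1
  ext n
  simp [bernoulliChar_chiThree]

theorem mk_eulerChar_mul :
    (mk fun m => eulerChar chiThree m 0 / (m ! : ℂ)) *
      (exp ℂ + rescale (-1 : ℂ) (exp ℂ) - 1) = -2 := by
  have h := congrArg (map Complex.ofRealHom) mk_eulerChar_real_mul
  simp only [map_mul, map_add, map_sub, map_one, map_neg, map_exp, map_rescale, map_ofNat] at h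
  rw [← h]
  congr 1
  ext n
  simp [eulerChar_chiThree]

/-- The power series of `(2 cosh z + 1) (2 cos z - 1)`. -/
def coshCosProd : PowerSeries ℂ :=
  (exp ℂ + rescale (-1 : ℂ) (exp ℂ) + 1) *
    (rescale Complex.I (exp ℂ) + rescale (-Complex.I) (exp ℂ) - 1)

theorem bernoulliChar_mul_eulerChar_mul_coshCosProd :
    (mk fun m => bernoulliChar chiThree m 0 / (m ! : ℂ)) *
      rescale Complex.I (mk fun m => eulerChar chiThree m 0 / (m ! : ℂ)) * coshCosProd =
      2 * X := by
  have h := congrArg (rescale Complex.I) mk_eulerChar_mul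
  simp only [map_mul, map_add, map_sub, map_one, map_neg, rescale_rescale, map_ofNat,
    neg_mul, one_mul] at h
  have h1 := mk_bernoulliChar_mul
  rw [coshCosProd, mul_mul_mul_comm, h1, h]
  ring

end PowerSeries

/-! ### Partial fractions from the cotangent expansion -/

/-- The odd function modulo `6` that takes the value `1` at `a` and vanishes off `±a`. -/
def oddSign (a n : ℕ) : ℝ :=
  if n % 6 = a then 1 else if n % 6 = 6 - a then -1 else 0

theorem abs_oddSign_le (a n : ℕ) : |oddSign a n| ≤ 1 := by
  unfold oddSign; split_ifs <;> simp

/-- The cutoff `6 N + 3` keeps complete pairs placed symmetrically about the multiples of `6`. This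
pairing matches the cotangent expansion and supplies the cancellation needed for the uniform bound.
-/
theorem sum_oddSign_smul {M : Type*} [AddCommGroup M] [Module ℝ M] {a : ℕ} (ha : a = 1 ∨ a = 2)
    (g : ℕ → M) (N : ℕ) :
    ∑ n ∈ range (6 * N + 3), oddSign a n • g n =
      g a + ∑ j ∈ range N, (g (6 * j + 6 + a) - g (6 * j + 6 - a)) := by
  induction N with
  | zero => rcases ha with rfl | rfl <;> simp [sum_range_succ, oddSign]
  | succ N ih =>
    have hr : 6 * (N + 1) + 3 = 6 * N + 3 + 6 := by ring
    have h0 : ∀ i, (6 * N + 3 + i) % 6 = (3 + i) % 6 := fun i => by omega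
    rw [hr, sum_range_add, ih, sum_range_succ _ N, add_assoc]
    congr 2
    rcases ha with rfl | rfl
    · simp only [sum_range_succ, sum_range_zero, oddSign, h0]
      norm_num
      rw [show 6 * N + 3 + 4 = 6 * N + 6 + 1 by ring, show 6 * N + 3 + 2 = 6 * N + 5 by ring]
      abel
    · simp only [sum_range_succ, sum_range_zero, oddSign, h0]
      norm_num
      rw [show 6 * N + 3 + 5 = 6 * N + 6 + 2 by ring, show 6 * N + 3 + 1 = 6 * N + 4 by ring,
        show 6 * N + 6 - 2 = 6 * N + 4 by omega]
      abel

/-- Partial sums of the partial fraction expansion of `1 / (cos (π w / 3) - cos (π a / 3))`. -/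
def cosPartialFrac (a N : ℕ) (w : ℂ) : ℂ :=
  ∑ n ∈ range (6 * N + 3), oddSign a n • ((n : ℂ) / ((n : ℂ) ^ 2 - w ^ 2))

/-- The limit of `cosPartialFrac`. -/
def cosPartialFracLim (a : ℕ) (w : ℂ) : ℂ :=
  (Real.pi : ℂ) / 6 * Complex.sin (Real.pi * a / 3) /
    (Complex.cos (Real.pi * w / 3) - Complex.cos (Real.pi * a / 3))

theorem sin_mul_sin_eq (u v : ℂ) :
    2 * (Complex.sin u * Complex.sin v) = Complex.cos (u - v) - Complex.cos (u + v) := by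
  rw [Complex.cos_sub, Complex.cos_add]; ring

theorem cos_sub_cos_ne_zero {a w : ℂ} (h1 : (w + a) / 6 ∈ Complex.integerComplement)
    (h2 : (w - a) / 6 ∈ Complex.integerComplement) :
    Complex.cos (Real.pi * w / 3) - Complex.cos (Real.pi * a / 3) ≠ 0 := by
  have e := sin_mul_sin_eq (Real.pi * ((w + a) / 6)) (Real.pi * ((w - a) / 6))
  rw [show (Real.pi * ((w + a) / 6) - Real.pi * ((w - a) / 6) : ℂ) = Real.pi * a / 3 by ring,
    show (Real.pi * ((w + a) / 6) + Real.pi * ((w - a) / 6) : ℂ) = Real.pi * w / 3 by ring] at e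
  intro h
  have s1 := sin_pi_mul_ne_zero h1
  have s2 := sin_pi_mul_ne_zero h2
  have : 2 * (Complex.sin (Real.pi * ((w + a) / 6)) * Complex.sin (Real.pi * ((w - a) / 6))) = 0 := by
    rw [e]; linear_combination -h
  exact mul_ne_zero two_ne_zero (mul_ne_zero s1 s2) this

theorem pi_mul_cot_sub_cot {a w : ℂ} (h1 : (w + a) / 6 ∈ Complex.integerComplement)
    (h2 : (w - a) / 6 ∈ Complex.integerComplement) :
    Complex.cot (Real.pi * ((w + a) / 6)) - Complex.cot (Real.pi * ((w - a) / 6)) =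
      2 * Complex.sin (Real.pi * a / 3) /
        (Complex.cos (Real.pi * w / 3) - Complex.cos (Real.pi * a / 3)) := by
  have e := sin_mul_sin_eq (Real.pi * ((w + a) / 6)) (Real.pi * ((w - a) / 6))
  have e' := Complex.sin_sub (Real.pi * ((w + a) / 6)) (Real.pi * ((w - a) / 6))
  have hne := cos_sub_cos_ne_zero h1 h2
  rw [show (Real.pi * ((w + a) / 6) - Real.pi * ((w - a) / 6) : ℂ) = Real.pi * a / 3 by ring]
    at e e'
  rw [show (Real.pi * ((w + a) / 6) + Real.pi * ((w - a) / 6) : ℂ) = Real.pi * w / 3 by ring] at e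
  have s1 := sin_pi_mul_ne_zero h1
  have s2 := sin_pi_mul_ne_zero h2
  rw [Complex.cot, Complex.cot, div_sub_div _ _ s1 s2, div_eq_div_iff (mul_ne_zero s1 s2) hne, e']
  linear_combination (Complex.cos (Real.pi * ((w + a) / 6)) * Complex.sin (Real.pi * ((w - a) / 6))
    - Complex.sin (Real.pi * ((w + a) / 6)) * Complex.cos (Real.pi * ((w - a) / 6))) * e

/-- The Mittag-Leffler expansions of `π cot (π x)` at `x = (w + a) / 6` and `x = (w - a) / 6` are
subtracted. The factor `1 / 12` combines `1 / 6` from the scaling with `1 / 2` from `n / (n² - w²) =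
(1 / (n - w) + 1 / (n + w)) / 2`. -/
theorem tendsto_cosPartialFrac {a : ℕ} (ha : a = 1 ∨ a = 2) {w : ℂ}
    (h1 : (w + a) / 6 ∈ Complex.integerComplement)
    (h2 : (w - a) / 6 ∈ Complex.integerComplement) :
    Tendsto (fun N => cosPartialFrac a N w) atTop (𝓝 (cosPartialFracLim a w)) := by
  have t := (((tendsto_logDeriv_euler_cot_sub h1).add_const (1 / ((w + a) / 6))).sub
    ((tendsto_logDeriv_euler_cot_sub h2).add_const (1 / ((w - a) / 6)))).const_mul (1 / 12 : ℂ)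
  have hl : (1 / 12 : ℂ) * (Real.pi * Complex.cot (Real.pi * ((w + a) / 6)) - 1 / ((w + a) / 6) +
      1 / ((w + a) / 6) - (Real.pi * Complex.cot (Real.pi * ((w - a) / 6)) - 1 / ((w - a) / 6) +
      1 / ((w - a) / 6))) = cosPartialFracLim a w := by
    rw [cosPartialFracLim, sub_add_cancel, sub_add_cancel, ← mul_sub, pi_mul_cot_sub_cot h1 h2]
    ring
  rw [hl] at t
  refine t.congr fun N => ?_
  have hp : ∀ m : ℤ, w + a + 6 * m ≠ 0 := fun m h => by
    apply Complex.integerComplement_add_ne_zero h1 m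
    linear_combination h / 6
  have hm : ∀ m : ℤ, w - a + 6 * m ≠ 0 := fun m h => by
    apply Complex.integerComplement_add_ne_zero h2 m
    linear_combination h / 6
  have hp0 : w + a ≠ 0 := by simpa using hp 0
  have hm0 : w - a ≠ 0 := by simpa using hm 0
  rw [cosPartialFrac, sum_oddSign_smul ha (fun n => (n : ℂ) / ((n : ℂ) ^ 2 - w ^ 2)),
    add_sub_add_comm, ← sum_sub_distrib, mul_add, mul_sum, add_comm]
  congr 1
  · rw [show (a : ℂ) ^ 2 - w ^ 2 = -((w + a) * (w - a)) by ring]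
    field_simp
    ring
  · refine sum_congr rfl fun j _ => ?_
    have ha6 : a ≤ 6 * j + 6 := by omega
    have q1 := hp (j + 1)
    have q2 := hp (-(j + 1))
    have q3 := hm (j + 1)
    have q4 := hm (-(j + 1))
    push_cast [Nat.cast_sub ha6] at q1 q2 q3 q4 ⊢
    have r1 : (w + a) / 6 - (j + 1) = (w + a + 6 * (-1 - j)) / 6 := by ring
    have r2 : (w + a) / 6 + (j + 1) = (w + a + 6 * (j + 1)) / 6 := by ring
    have r3 : (w - a) / 6 - (j + 1) = (w - a + 6 * (-1 - j)) / 6 := by ring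
    have r4 : (w - a) / 6 + (j + 1) = (w - a + 6 * (j + 1)) / 6 := by ring
    have r5 : (6 * j + 6 + a : ℂ) ^ 2 - w ^ 2 =
      -((w + a + 6 * (j + 1)) * (w - a + 6 * (-1 - j))) := by ring
    have r6 : (6 * j + 6 - a : ℂ) ^ 2 - w ^ 2 =
      -((w - a + 6 * (j + 1)) * (w + a + 6 * (-1 - j))) := by ring
    have q2' : w + a + 6 * (-1 - j : ℂ) ≠ 0 := by convert q2 using 2; ring
    have q4' : w - a + 6 * (-1 - j : ℂ) ≠ 0 := by convert q4 using 2; ring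
    rw [cotTerm, cotTerm, r1, r2, r3, r4, r5, r6]
    set A := w + a + 6 * (-1 - j : ℂ) with hA
    set B := w + a + 6 * (j + 1 : ℂ) with hB
    set D := w - a + 6 * (-1 - j : ℂ) with hD
    set E := w - a + 6 * (j + 1 : ℂ) with hE
    have k1 : (6 * j + 6 + a : ℂ) = (B - D) / 2 := by rw [hB, hD]; ring
    have k2 : (6 * j + 6 - a : ℂ) = (E - A) / 2 := by rw [hE, hA]; ring
    rw [k1, k2]
    field_simp
    ring

theorem integerComplement_of_im_ne_zero {w : ℂ} (h : w.im ≠ 0) : w ∈ Complex.integerComplement := by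
  rintro ⟨n, rfl⟩
  simp at h

theorem I_mul_natCast_add_mem {n : ℕ} (hn : n ≠ 0) (a : ℝ) :
    (Complex.I * n + a) / 6 ∈ Complex.integerComplement := by
  apply integerComplement_of_im_ne_zero
  simp [hn]

theorem add_natCast_mem_of_norm_lt_one {a : ℕ} (ha : a = 1 ∨ a = 2) {w : ℂ} (hw : ‖w‖ < 1) :
    (w + a) / 6 ∈ Complex.integerComplement ∧ (w - a) / 6 ∈ Complex.integerComplement := by
  constructor
  · rintro ⟨n, hn⟩
    have h : w = ((6 * n - a : ℤ) : ℂ) := by push_cast; linear_combination -6 * hn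
    rw [h, Complex.norm_intCast] at hw
    have hw' : |6 * n - (a : ℤ)| < 1 := by exact_mod_cast hw
    rw [Int.abs_lt_one_iff] at hw'
    omega
  · rintro ⟨n, hn⟩
    have h : w = ((6 * n + a : ℤ) : ℂ) := by push_cast; linear_combination -6 * hn
    rw [h, Complex.norm_intCast] at hw
    have hw' : |6 * n + (a : ℤ)| < 1 := by exact_mod_cast hw
    rw [Int.abs_lt_one_iff] at hw'
    omega

/-! ### Uniform bounds and dominated convergence -/

theorem abs_sub_div_sq_add_sq_le {s t y : ℝ} (ht : 0 < t) (hst : t ≤ s) (hy : 0 < y) :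
    |s / (s ^ 2 + y ^ 2) - t / (t ^ 2 + y ^ 2)| ≤ (s - t) / (t ^ 2 + y ^ 2) := by
  have hs : 0 < s := by linarith
  rw [div_sub_div _ _ (by positivity) (by positivity), abs_div,
    abs_of_pos (show 0 < (s ^ 2 + y ^ 2) * (t ^ 2 + y ^ 2) by positivity),
    div_le_div_iff₀ (by positivity) (by positivity),
    show s * (t ^ 2 + y ^ 2) - (s ^ 2 + y ^ 2) * t = (s - t) * (y ^ 2 - s * t) by ring, abs_mul,
    abs_of_nonneg (sub_nonneg.2 hst)]
  have h : |y ^ 2 - s * t| ≤ s ^ 2 + y ^ 2 := by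
    rw [abs_le]; constructor <;> nlinarith
  calc (s - t) * |y ^ 2 - s * t| * (t ^ 2 + y ^ 2)
      ≤ (s - t) * (s ^ 2 + y ^ 2) * (t ^ 2 + y ^ 2) := by
        gcongr
    _ = _ := by ring

/-- The leading term is at most `2 / y`. Each pair is at most `4 / ((j + 1)² + y²)`, hence at most
`8 / ((j + y)(j + 1 + y))`, which telescopes to a total below `8 / y`. -/
theorem abs_sum_oddSign_div_le {a : ℕ} (ha : a = 1 ∨ a = 2) (N : ℕ) {y : ℝ} (hy : 1 ≤ y) :
    |∑ n ∈ range (6 * N + 3), oddSign a n • ((n : ℝ) / ((n : ℝ) ^ 2 + y ^ 2))| ≤ 10 / y := by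
  have hy0 : 0 < y := by linarith
  have ha' : (1 : ℝ) ≤ a ∧ (a : ℝ) ≤ 2 := by rcases ha with rfl | rfl <;> norm_num
  rw [sum_oddSign_smul ha (fun n => (n : ℝ) / ((n : ℝ) ^ 2 + y ^ 2))]
  have hsum : |∑ j ∈ range N, (((6 * j + 6 + a : ℕ) : ℝ) / (((6 * j + 6 + a : ℕ) : ℝ) ^ 2 + y ^ 2) -
      ((6 * j + 6 - a : ℕ) : ℝ) / (((6 * j + 6 - a : ℕ) : ℝ) ^ 2 + y ^ 2))| ≤
      ∑ j ∈ range N, 8 * (1 / ((j : ℝ) + y) - 1 / (((j + 1 : ℕ) : ℝ) + y)) := by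
    refine (abs_sum_le_sum_abs _ _).trans (sum_le_sum fun j _ => ?_)
    have ha6 : a ≤ 6 * j + 6 := by omega
    have hj : (0 : ℝ) ≤ j := j.cast_nonneg
    push_cast [Nat.cast_sub ha6]
    refine (abs_sub_div_sq_add_sq_le (by linarith) (by linarith) hy0).trans ?_
    rw [div_sub_div _ _ (by positivity) (by positivity), mul_div_assoc',
      div_le_div_iff₀ (by positivity) (by positivity)]
    have e1 : (6 * j + 6 + a - (6 * j + 6 - a) : ℝ) ≤ 4 := by linarith
    have e2 : ((j : ℝ) + 1) ^ 2 ≤ (6 * j + 6 - a : ℝ) ^ 2 := by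
      apply pow_le_pow_left₀ (by linarith); linarith
    have e3 : ((j : ℝ) + y) * (j + 1 + y) ≤ 2 * ((j + 1 : ℝ) ^ 2 + y ^ 2) := by
      nlinarith [sq_nonneg ((j : ℝ) + 1 - y)]
    calc (6 * j + 6 + a - (6 * j + 6 - a) : ℝ) * (((j : ℝ) + y) * (j + 1 + y))
        ≤ 4 * (2 * ((j + 1 : ℝ) ^ 2 + y ^ 2)) := by gcongr
      _ ≤ 4 * (2 * ((6 * j + 6 - a : ℝ) ^ 2 + y ^ 2)) := by gcongr
      _ = _ := by ring
  rw [← mul_sum, sum_range_sub' (fun j : ℕ => 1 / ((j : ℝ) + y))] at hsum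
  have h1 : |(a : ℝ) / ((a : ℝ) ^ 2 + y ^ 2)| ≤ 2 / y := by
    rw [abs_of_nonneg (by positivity)]
    apply div_le_div₀ (by norm_num) ha'.2 hy0
    nlinarith [sq_nonneg (a : ℝ)]
  have h2 : 0 ≤ 1 / ((N : ℝ) + y) := by positivity
  have h3 : 10 / y = 2 / y + 8 * (1 / y) := by ring
  refine (abs_add_le _ _).trans ?_
  simp only [Nat.cast_zero, zero_add] at hsum
  linarith

theorem norm_cosPartialFrac_le {a : ℕ} (ha : a = 1 ∨ a = 2) (N : ℕ) {n : ℕ} (hn : n ≠ 0) :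
    ‖cosPartialFrac a N (Complex.I * n)‖ ≤ 10 / n := by
  have h : cosPartialFrac a N (Complex.I * n) =
      ((∑ k ∈ range (6 * N + 3), oddSign a k • ((k : ℝ) / ((k : ℝ) ^ 2 + (n : ℝ) ^ 2)) : ℝ) : ℂ) := by
    simp [cosPartialFrac, mul_pow]
  rw [h, Complex.norm_real]
  exact abs_sum_oddSign_div_le ha N (by exact_mod_cast Nat.one_le_iff_ne_zero.2 hn)

theorem oddSign_zero {a : ℕ} (ha : a = 1 ∨ a = 2) : oddSign a 0 = 0 := by
  rcases ha with rfl | rfl <;> simp [oddSign]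

theorem one_sub_mul_sq_le_norm {w : ℂ} {n : ℕ} (hn : n ≠ 0) :
    (1 - ‖w‖ ^ 2) * (n : ℝ) ^ 2 ≤ ‖(n : ℂ) ^ 2 - w ^ 2‖ := by
  have h1 : (1 : ℝ) ≤ (n : ℝ) ^ 2 :=
    one_le_pow₀ (by exact_mod_cast Nat.one_le_iff_ne_zero.2 hn)
  have h2 := norm_sub_norm_le ((n : ℂ) ^ 2) (w ^ 2)
  simp only [norm_pow, Complex.norm_natCast] at h2
  nlinarith [sq_nonneg ‖w‖]

theorem natCast_sq_sub_sq_ne_zero {w : ℂ} (hw : ‖w‖ < 1) {n : ℕ} (hn : n ≠ 0) :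
    (n : ℂ) ^ 2 - w ^ 2 ≠ 0 := by
  rw [← norm_pos_iff]
  refine lt_of_lt_of_le ?_ (one_sub_mul_sq_le_norm hn)
  have : ‖w‖ ^ 2 < 1 := pow_lt_one₀ (norm_nonneg w) hw two_ne_zero
  have hn' : (0 : ℝ) < n := by exact_mod_cast Nat.pos_of_ne_zero hn
  have : 0 < 1 - ‖w‖ ^ 2 := by linarith
  positivity

/-- The factor `n / (n² - w²)` is `O(1 / n)` and the truncated inner sum is at most `10 / n`
uniformly in `N`, so a multiple of `1 / n²` dominates. -/
theorem tendsto_sum_mul_cosPartialFrac {a b : ℕ} (ha : a = 1 ∨ a = 2) (hb : b = 1 ∨ b = 2) {w : ℂ}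
    (hw : ‖w‖ < 1) :
    Tendsto (fun N => ∑ n ∈ range (6 * N + 3), oddSign a n • ((n : ℂ) / ((n : ℂ) ^ 2 - w ^ 2)) *
        cosPartialFrac b N (Complex.I * n)) atTop
      (𝓝 (∑' n : ℕ, oddSign a n • ((n : ℂ) / ((n : ℂ) ^ 2 - w ^ 2)) *
        cosPartialFracLim b (Complex.I * n))) := by
  have hw2 : ‖w‖ ^ 2 < 1 := pow_lt_one₀ (norm_nonneg w) hw two_ne_zero
  have hw3 : 0 < 1 - ‖w‖ ^ 2 := by linarith
  -- Extension by zero beyond the cutoff turns the finite sums into sums over all of `ℕ`.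
  set f : ℕ → ℕ → ℂ := fun N n => if n ∈ range (6 * N + 3) then
    oddSign a n • ((n : ℂ) / ((n : ℂ) ^ 2 - w ^ 2)) * cosPartialFrac b N (Complex.I * n) else 0
    with hf
  have hsum : ∀ N, ∑' n, f N n = ∑ n ∈ range (6 * N + 3),
      oddSign a n • ((n : ℂ) / ((n : ℂ) ^ 2 - w ^ 2)) * cosPartialFrac b N (Complex.I * n) := by
    intro N
    rw [tsum_eq_sum (s := range (6 * N + 3)) (fun n hn => by simp only [hf, if_neg hn])]
    exact sum_congr rfl fun n hn => by simp only [hf, if_pos hn]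
  simp_rw [← hsum]
  refine tendsto_tsum_of_dominated_convergence
    (bound := fun n : ℕ => 10 / (1 - ‖w‖ ^ 2) * (1 / (n : ℝ) ^ 2)) ?_ ?_ ?_
  · exact (Real.summable_one_div_nat_pow.2 one_lt_two).mul_left _
  · intro n
    rcases eq_or_ne n 0 with rfl | hn
    · simp [hf, oddSign_zero ha]
    · have ht := tendsto_cosPartialFrac hb (w := Complex.I * n)
        (by exact_mod_cast I_mul_natCast_add_mem hn b)
        (by simpa [sub_eq_add_neg] using I_mul_natCast_add_mem hn (-b))
      refine (ht.const_mul _).congr' ?_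
      filter_upwards [eventually_ge_atTop n] with N hN
      simp only [hf, if_pos (mem_range.2 (show n < 6 * N + 3 by omega))]
  · refine Eventually.of_forall fun N n => ?_
    rcases eq_or_ne n 0 with rfl | hn
    · simp [hf, oddSign_zero ha]
    · have hn' : (0 : ℝ) < n := by exact_mod_cast Nat.pos_of_ne_zero hn
      simp only [hf]
      split_ifs with hN
      · rw [norm_mul, norm_smul, norm_div, Complex.norm_natCast, Real.norm_eq_abs]
        calc |oddSign a n| * (n / ‖(n : ℂ) ^ 2 - w ^ 2‖) * ‖cosPartialFrac b N (Complex.I * n)‖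
            ≤ 1 * (n / ((1 - ‖w‖ ^ 2) * (n : ℝ) ^ 2)) * (10 / n) := by
              gcongr
              · exact abs_oddSign_le a n
              · exact one_sub_mul_sq_le_norm hn
              · exact norm_cosPartialFrac_le hb N hn
          _ = _ := by field_simp
      · simp only [norm_zero]; positivity

/-! ### Product of two partial fraction expansions -/

/-- Both factors have the same cutoff, so the two finite sums may be exchanged freely after the
termwise splitting. -/
theorem cosPartialFrac_mul_cosPartialFrac (a b : ℕ) {w : ℂ} (hw : ‖w‖ < 1) (N : ℕ) :
    cosPartialFrac a N w * cosPartialFrac b N (Complex.I * w) =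
      ∑ n ∈ range (6 * N + 3), oddSign a n • ((n : ℂ) / ((n : ℂ) ^ 2 - w ^ 2)) *
        cosPartialFrac b N (Complex.I * n) +
      ∑ n ∈ range (6 * N + 3),
        oddSign b n • ((n : ℂ) / ((n : ℂ) ^ 2 - (Complex.I * w) ^ 2)) *
        cosPartialFrac a N (Complex.I * n) := by
  have hIw : ‖Complex.I * w‖ < 1 := by simpa using hw
  simp only [cosPartialFrac]
  rw [sum_mul_sum]
  simp only [mul_sum]
  rw [sum_comm (f := fun k n : ℕ => oddSign b k • ((k : ℂ) / ((k : ℂ) ^ 2 - (Complex.I * w) ^ 2)) *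
    oddSign a n • ((n : ℂ) / ((n : ℂ) ^ 2 - (Complex.I * k) ^ 2))), ← sum_add_distrib]
  refine sum_congr rfl fun n _ => ?_
  rw [← sum_add_distrib]
  refine sum_congr rfl fun k _ => ?_
  rcases eq_or_ne n 0 with rfl | hn
  · simp
  rcases eq_or_ne k 0 with rfl | hk
  · simp
  have h1 := natCast_sq_sub_sq_ne_zero hw hn
  have h2 := natCast_sq_sub_sq_ne_zero hIw hk
  have h3 : (n : ℂ) ^ 2 + (k : ℂ) ^ 2 ≠ 0 := by
    have : n ^ 2 + k ^ 2 ≠ 0 := by positivity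
    exact_mod_cast this
  simp only [Complex.real_smul, mul_pow, Complex.I_sq, neg_one_mul, sub_neg_eq_add] at h2 ⊢
  have h3' : (k : ℂ) ^ 2 + (n : ℂ) ^ 2 ≠ 0 := by rwa [add_comm]
  rw [add_comm ((k : ℂ) ^ 2) ((n : ℂ) ^ 2)]
  field_simp
  ring

theorem cosPartialFracLim_mul_cosPartialFracLim {a b : ℕ} (ha : a = 1 ∨ a = 2)
    (hb : b = 1 ∨ b = 2) {w : ℂ} (hw : ‖w‖ < 1) :
    cosPartialFracLim a w * cosPartialFracLim b (Complex.I * w) =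
      ∑' n : ℕ, oddSign a n • ((n : ℂ) / ((n : ℂ) ^ 2 - w ^ 2)) *
        cosPartialFracLim b (Complex.I * n) +
      ∑' n : ℕ, oddSign b n • ((n : ℂ) / ((n : ℂ) ^ 2 - (Complex.I * w) ^ 2)) *
        cosPartialFracLim a (Complex.I * n) := by
  have hIw : ‖Complex.I * w‖ < 1 := by simpa using hw
  have m1 := add_natCast_mem_of_norm_lt_one ha hw
  have m2 := add_natCast_mem_of_norm_lt_one hb hIw
  refine tendsto_nhds_unique ((tendsto_cosPartialFrac ha m1.1 m1.2).mul
    (tendsto_cosPartialFrac hb m2.1 m2.2)) ?_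
  simp_rw [cosPartialFrac_mul_cosPartialFrac a b hw]
  exact (tendsto_sum_mul_cosPartialFrac ha hb hw).add (tendsto_sum_mul_cosPartialFrac hb ha hIw)

/-! ### Hyperbolic denominators and the expansion in powers of `w` -/

theorem le_two_mul_cosh_sub_one (n : ℕ) :
    1 + (n : ℝ) ^ 2 ≤ 2 * Real.cosh (n * Real.pi / 3) - 1 := by
  have h : ∀ x : ℝ, 1 + x ^ 2 / 2 ≤ Real.cosh x := fun x => by
    have h1 := Real.cosh_two_mul (x / 2)
    have h2 := Real.cosh_sq (x / 2)
    have h3 : (x / 2) ^ 2 ≤ Real.sinh (x / 2) ^ 2 := by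
      apply sq_le_sq.2
      rw [Real.abs_sinh]
      exact Real.self_le_sinh_iff.2 (abs_nonneg _)
    rw [mul_div_cancel₀ x two_ne_zero] at h1
    linarith
  replace h := h (n * Real.pi / 3)
  have h2 : (n : ℝ) ≤ n * Real.pi / 3 := by
    have := Real.pi_gt_three
    rw [le_div_iff₀ three_pos]; gcongr
  have : (n : ℝ) ^ 2 ≤ (n * Real.pi / 3) ^ 2 := by gcongr
  linarith

/-- The denominator `2 cosh (n π / 3) - (-1) ^ n`. -/
def coshDenom (n : ℕ) : ℝ := 2 * Real.cosh (n * Real.pi / 3) - (-1) ^ n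

theorem sq_lt_coshDenom (n : ℕ) : (n : ℝ) ^ 2 < coshDenom n := by
  have h := le_two_mul_cosh_sub_one n
  rw [coshDenom]
  rcases neg_one_pow_eq_or ℝ n with h1 | h1 <;> rw [h1] <;> linarith

theorem coshDenom_pos (n : ℕ) : 0 < coshDenom n := (sq_nonneg _).trans_lt (sq_lt_coshDenom n)

theorem sin_pi_mul_div_three {a : ℕ} (ha : a = 1 ∨ a = 2) :
    Complex.sin (Real.pi * a / 3) = ((Real.sqrt 3 / 2 : ℝ) : ℂ) := by
  rw [← Real.sin_pi_div_three]
  rcases ha with rfl | rfl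
  · push_cast; rw [mul_one]
  · rw [← Real.sin_pi_sub, Complex.ofReal_sin]
    congr 1; push_cast; ring

theorem two_mul_cos_pi_mul_div_three {a : ℕ} (ha : a = 1 ∨ a = 2) :
    2 * Complex.cos (Real.pi * a / 3) = -(-1) ^ a := by
  have h : Complex.cos (Real.pi / 3) = 1 / 2 := by
    have := congrArg Complex.ofReal Real.cos_pi_div_three
    push_cast at this
    exact this
  rcases ha with rfl | rfl
  · simp [h]
  · have : (Real.pi * (2 : ℕ) / 3 : ℂ) = Real.pi - Real.pi / 3 := by push_cast; ring
    rw [this, Complex.cos_pi_sub, h]; norm_num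

theorem cosPartialFracLim_eq {a : ℕ} (ha : a = 1 ∨ a = 2) (w : ℂ) :
    cosPartialFracLim a w = ((Real.pi * Real.sqrt 3 / 6 : ℝ) : ℂ) /
      (2 * Complex.cos (Real.pi * w / 3) + (-1) ^ a) := by
  have h := two_mul_cos_pi_mul_div_three ha
  have e : 2 * Complex.cos (Real.pi * w / 3) + (-1) ^ a =
    2 * (Complex.cos (Real.pi * w / 3) - Complex.cos (Real.pi * a / 3)) := by
      linear_combination h
  rw [cosPartialFracLim, e, sin_pi_mul_div_three ha]
  push_cast
  rw [div_mul_eq_div_div]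
  ring

/-- On the support of `oddSign a`, `n` has the parity of `a`, and `a + b = 3` makes `b` of opposite
parity. This is the source of `-(-1) ^ n` in the denominator. -/
theorem oddSign_mul_cosPartialFracLim {a b : ℕ} (ha : a = 1 ∨ a = 2) (hb : b = 1 ∨ b = 2)
    (hab : a + b = 3) (n : ℕ) :
    oddSign a n • cosPartialFracLim b (Complex.I * n) =
      ((Real.pi * Real.sqrt 3 / 6 : ℝ) : ℂ) * (oddSign a n / coshDenom n : ℝ) := by
  by_cases h0 : oddSign a n = 0
  · simp [h0]
  have hpar : (-1 : ℂ) ^ b = -(-1) ^ n := by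
    unfold oddSign at h0
    split_ifs at h0 with h1 h1
    · rcases ha with rfl | rfl
      · obtain rfl : b = 2 := by omega
        rw [Odd.neg_one_pow (n := n) (Nat.odd_iff.2 (by omega))]; norm_num
      · obtain rfl : b = 1 := by omega
        rw [Even.neg_one_pow (n := n) (Nat.even_iff.2 (by omega))]; norm_num
    · rcases ha with rfl | rfl
      · obtain rfl : b = 2 := by omega
        rw [Odd.neg_one_pow (n := n) (Nat.odd_iff.2 (by omega))]; norm_num
      · obtain rfl : b = 1 := by omega
        rw [Even.neg_one_pow (n := n) (Nat.even_iff.2 (by omega))]; norm_num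
    · exact absurd rfl h0
  have hc : Complex.cos (Real.pi * (Complex.I * n) / 3) = Complex.cosh (n * Real.pi / 3) := by
    rw [← Complex.cos_mul_I]; congr 1; ring
  rw [cosPartialFracLim_eq hb, hc, hpar, coshDenom, Complex.real_smul]
  push_cast
  ring

/-- Power series coefficients of `∑' n, oddSign a n / coshDenom n * n / (n ^ 2 - w ^ 2)`. -/
def invCoshCoeff (a i : ℕ) : ℂ :=
  (1 + (-1) ^ i) / 2 * ∑' n : ℕ, ((oddSign a n / coshDenom n / (n : ℝ) ^ (i + 1) : ℝ) : ℂ)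

theorem abs_oddSign_div_coshDenom_le (a n i : ℕ) :
    |oddSign a n / coshDenom n / (n : ℝ) ^ (i + 1)| ≤ 1 / (n : ℝ) ^ 2 := by
  -- At `n = 0` both sides vanish, as division by zero gives zero.
  rcases Nat.eq_zero_or_pos n with rfl | hn
  · simp
  have hn' : (0 : ℝ) < n := by exact_mod_cast hn
  have h1 : (1 : ℝ) ≤ n ^ (i + 1) := one_le_pow₀ (by exact_mod_cast hn)
  rw [abs_div, abs_div, abs_of_pos (coshDenom_pos n), abs_of_pos (by positivity : (0 : ℝ) <
    n ^ (i + 1))]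
  calc |oddSign a n| / coshDenom n / (n : ℝ) ^ (i + 1) ≤ 1 / (n : ℝ) ^ 2 / 1 := by
        gcongr
        · exact abs_oddSign_le a n
        · exact (sq_lt_coshDenom n).le
    _ = _ := div_one _

theorem summable_oddSign_div_coshDenom (a i : ℕ) :
    Summable fun n : ℕ => oddSign a n / coshDenom n / (n : ℝ) ^ (i + 1) :=
  Summable.of_norm_bounded (Real.summable_one_div_nat_pow.2 one_lt_two) fun n =>
    abs_oddSign_div_coshDenom_le a n i

theorem hasSum_even_geometric {w : ℂ} (hw : ‖w‖ < 1) {n : ℕ} (hn : n ≠ 0) :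
    HasSum (fun i : ℕ => (1 + (-1) ^ i) / 2 * (1 / (n : ℂ) ^ (i + 1)) * w ^ i)
      ((n : ℂ) / ((n : ℂ) ^ 2 - w ^ 2)) := by
  have hn' : (n : ℂ) ≠ 0 := by exact_mod_cast hn
  have hn1 : (1 : ℝ) ≤ n := by exact_mod_cast Nat.one_le_iff_ne_zero.2 hn
  have hlt : ‖w / n‖ < 1 := by
    rw [norm_div, Complex.norm_natCast]
    exact (div_le_self (norm_nonneg w) hn1).trans_lt hw
  have g1 := (hasSum_geometric_of_norm_lt_one hlt).mul_left (1 / (2 * n : ℂ))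
  have g2 := (hasSum_geometric_of_norm_lt_one (ξ := -(w / n)) (by rwa [norm_neg])).mul_left
    (1 / (2 * n : ℂ))
  have hne := natCast_sq_sub_sq_ne_zero hw hn
  have hf : (n : ℂ) ^ 2 - w ^ 2 = (n - w) * (n + w) := by ring
  rw [hf] at hne ⊢
  have h1 := left_ne_zero_of_mul hne
  have h2 := right_ne_zero_of_mul hne
  convert! g1.add g2 using 1
  · ext i
    rw [neg_pow (w / n), div_pow, pow_succ]
    field_simp
  · have e1 : 1 - w / n = (n - w) / n := by field_simp
    have e2 : 1 - -(w / n) = (n + w) / n := by field_simp; ring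
    rw [e1, e2]
    field_simp
    ring

/-- Geometric expansion followed by an exchange of summations, with majorant `‖w‖ ^ i / n²` on `ℕ ×
ℕ`. -/
theorem hasSum_invCoshCoeff (a : ℕ) {w : ℂ} (hw : ‖w‖ < 1) :
    HasSum (fun i => invCoshCoeff a i * w ^ i)
      (∑' n : ℕ, ((oddSign a n / coshDenom n : ℝ) : ℂ) * ((n : ℂ) / ((n : ℂ) ^ 2 - w ^ 2))) := by
  set F : ℕ × ℕ → ℂ := fun q => (1 + (-1) ^ q.1) / 2 *
    ((oddSign a q.2 / coshDenom q.2 / (q.2 : ℝ) ^ (q.1 + 1) : ℝ) : ℂ) * w ^ q.1 with hF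
  have hFs : Summable F := by
    have hg : Summable fun q : ℕ × ℕ => ‖w‖ ^ q.1 * (1 / (q.2 : ℝ) ^ 2) :=
      (summable_geometric_of_lt_one (norm_nonneg w) hw).mul_of_nonneg
        (Real.summable_one_div_nat_pow.2 one_lt_two) (fun _ => by positivity)
        (fun _ => by positivity)
    refine Summable.of_norm_bounded hg fun q => ?_
    rw [hF, norm_mul, norm_mul, norm_pow, Complex.norm_real, Real.norm_eq_abs,
      mul_comm (‖w‖ ^ q.1)]
    have h1 : ‖((1 + (-1) ^ q.1) / 2 : ℂ)‖ ≤ 1 := by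
      rcases neg_one_pow_eq_or ℂ q.1 with h | h <;> rw [h] <;> norm_num
    calc _ ≤ 1 * (1 / (q.2 : ℝ) ^ 2) * ‖w‖ ^ q.1 := by
          gcongr
          exact abs_oddSign_div_coshDenom_le a _ _
      _ = _ := by rw [one_mul]
  have hrow : ∀ i, HasSum (fun n => F (i, n)) (invCoshCoeff a i * w ^ i) := fun i => by
    have h := (Complex.hasSum_ofReal.2 (summable_oddSign_div_coshDenom a i).hasSum |>.mul_left
      ((1 + (-1) ^ i) / 2 : ℂ)).mul_right (w ^ i)
    rwa [Complex.ofReal_tsum] at h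
  have hcol : ∀ n, HasSum (fun i => F (i, n))
      (((oddSign a n / coshDenom n : ℝ) : ℂ) * ((n : ℂ) / ((n : ℂ) ^ 2 - w ^ 2))) := fun n => by
    rcases eq_or_ne n 0 with rfl | hn
    · simp [hF]
    · convert! (hasSum_even_geometric hw hn).mul_left ((oddSign a n / coshDenom n : ℝ) : ℂ) using 1
      ext i
      simp only [hF]; push_cast; ring
  have hT := hFs.hasSum
  have hr := hT.prod_fiberwise hrow
  have hc := ((Equiv.prodComm ℕ ℕ).hasSum_iff.2 hT).prod_fiberwise hcol
  rwa [hc.tsum_eq]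

/-! ### From identities of functions on the unit disc to identities of power series -/

namespace PowerSeries

/-- The power series `P` converges on the open unit disc with sum `f`. -/
def HasSumOnUnitDisc (P : PowerSeries ℂ) (f : ℂ → ℂ) : Prop :=
  ∀ w : ℂ, ‖w‖ < 1 → HasSum (fun i => coeff i P * w ^ i) (f w)

namespace HasSumOnUnitDisc

variable {P Q : PowerSeries ℂ} {f g : ℂ → ℂ}

theorem add (hP : HasSumOnUnitDisc P f) (hQ : HasSumOnUnitDisc Q g) :
    HasSumOnUnitDisc (P + Q) (fun w => f w + g w) := fun w hw => by
  simpa [add_mul] using (hP w hw).add (hQ w hw)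

theorem sub (hP : HasSumOnUnitDisc P f) (hQ : HasSumOnUnitDisc Q g) :
    HasSumOnUnitDisc (P - Q) (fun w => f w - g w) := fun w hw => by
  simpa [sub_mul] using (hP w hw).sub (hQ w hw)

theorem mul (hP : HasSumOnUnitDisc P f) (hQ : HasSumOnUnitDisc Q g) :
    HasSumOnUnitDisc (P * Q) (fun w => f w * g w) := fun w hw => by
  have hp := (hP w hw).summable.norm
  have hq := (hQ w hw).summable.norm
  have h := tsum_mul_tsum_eq_tsum_sum_antidiagonal_of_summable_norm hp hq
  have hs := (summable_norm_sum_mul_antidiagonal_of_summable_norm hp hq).of_norm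
  have hh := hs.hasSum
  rw [← h, (hP w hw).tsum_eq, (hQ w hw).tsum_eq] at hh
  convert! hh using 2 with i
  rw [coeff_mul, sum_mul]
  refine sum_congr rfl fun q hq => ?_
  rw [← mem_antidiagonal.1 hq, pow_add]
  ring

theorem C (c : ℂ) : HasSumOnUnitDisc (PowerSeries.C c) (fun _ => c) := fun w _ => by
  have h := hasSum_single (f := fun i => coeff i (PowerSeries.C c) * w ^ i) 0 fun i hi => by
    simp [coeff_C, hi]
  simpa only [coeff_zero_C, pow_zero, mul_one] using h

theorem one : HasSumOnUnitDisc 1 (fun _ => 1) := by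
  simpa using C 1

theorem rescale_exp (c : ℂ) :
    HasSumOnUnitDisc (PowerSeries.rescale c (exp ℂ)) (fun w => Complex.exp (c * w)) :=
  fun w _ => by
    have h := NormedSpace.expSeries_div_hasSum_exp (𝔸 := ℂ) (c * w)
    rw [← Complex.exp_eq_exp_ℂ] at h
    convert! h using 2 with i
    simp [coeff_exp, mul_pow]
    ring

theorem rescale {c : ℂ} (hc : ‖c‖ ≤ 1) (hP : HasSumOnUnitDisc P f) :
    HasSumOnUnitDisc (PowerSeries.rescale c P) (fun w => f (c * w)) := fun w hw => by
  have h := hP (c * w) (by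
    rw [norm_mul]
    exact (mul_le_of_le_one_left (norm_nonneg w) hc).trans_lt hw)
  convert! h using 2 with i
  rw [coeff_rescale, mul_pow]
  ring

theorem hasFPowerSeriesAt (hP : HasSumOnUnitDisc P f) :
    HasFPowerSeriesAt f (FormalMultilinearSeries.ofScalars ℂ fun i => coeff i P) 0 := by
  rw [hasFPowerSeriesAt_iff]
  filter_upwards [Metric.ball_mem_nhds (0 : ℂ) one_pos] with w hw
  have h := hP w (by simpa using hw)
  simpa [FormalMultilinearSeries.coeff_ofScalars, mul_comm] using h

theorem unique (hP : HasSumOnUnitDisc P f) (hQ : HasSumOnUnitDisc Q g)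
    (hfg : ∀ w : ℂ, ‖w‖ < 1 → f w = g w) : P = Q := by
  have hQ' : HasSumOnUnitDisc Q f := fun w hw => by rw [hfg w hw]; exact hQ w hw
  have h := hP.hasFPowerSeriesAt.eq_formalMultilinearSeries hQ'.hasFPowerSeriesAt
  ext i
  simpa [FormalMultilinearSeries.coeff_ofScalars] using
    congrArg (fun F => FormalMultilinearSeries.coeff F i) h

end HasSumOnUnitDisc

theorem hasSumOnUnitDisc_coshCosProd (c : ℂ) :
    HasSumOnUnitDisc (rescale c coshCosProd) fun w =>
      (2 * Complex.cosh (c * w) + 1) * (2 * Complex.cos (c * w) - 1) := by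
  have h := (((HasSumOnUnitDisc.rescale_exp c).add (.rescale_exp (-c))).add .one).mul
    (((HasSumOnUnitDisc.rescale_exp (Complex.I * c)).add (.rescale_exp (-(Complex.I * c)))).sub .one)
  have e : ∀ x, (rescale c) ((rescale x) (exp ℂ)) = rescale (x * c) (exp ℂ) := fun x => by
    rw [rescale_rescale]
  have e' : rescale c coshCosProd =
      (rescale c (exp ℂ) + rescale (-c) (exp ℂ) + 1) *
      (rescale (Complex.I * c) (exp ℂ) + rescale (-(Complex.I * c)) (exp ℂ) - 1) := by
    simp only [coshCosProd, map_mul, map_add, map_sub, map_one, e, neg_mul, one_mul]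
  rw [e']
  convert! h using 2 with w
  rw [Complex.two_cosh, Complex.two_cos]
  ring_nf

/-- The power series of `(π √3 / 6) / ((2 cosh (π w / 3) + 1) (2 cos (π w / 3) - 1))`. -/
def invCoshCosSeries : PowerSeries ℂ :=
  mk (invCoshCoeff 1) + rescale Complex.I (mk (invCoshCoeff 2))

theorem invCoshCosSeries_mul :
    invCoshCosSeries * rescale (Real.pi / 3 : ℂ) coshCosProd =
      C ((Real.pi * Real.sqrt 3 / 6 : ℝ) : ℂ) := by
  have hK : ∀ a, HasSumOnUnitDisc (mk (invCoshCoeff a)) _ := fun a w hw => by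
    simp only [coeff_mk]
    exact hasSum_invCoshCoeff a hw
  refine (((hK 1).add ((hK 2).rescale (c := Complex.I) (by simp))).mul
    (hasSumOnUnitDisc_coshCosProd (Real.pi / 3 : ℂ))).unique (.C _) fun w hw => ?_
  have h1 : (1 : ℕ) = 1 ∨ (1 : ℕ) = 2 := .inl rfl
  have h2 : (2 : ℕ) = 1 ∨ (2 : ℕ) = 2 := .inr rfl
  have key := cosPartialFracLim_mul_cosPartialFracLim h1 h2 hw
  have hc : ((Real.pi * Real.sqrt 3 / 6 : ℝ) : ℂ) ≠ 0 :=
    Complex.ofReal_ne_zero.2 (by have := Real.pi_pos; positivity)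
  have t : ∀ {a b : ℕ}, (a = 1 ∨ a = 2) → (b = 1 ∨ b = 2) → a + b = 3 → ∀ v : ℂ,
      ∑' n : ℕ, oddSign a n • ((n : ℂ) / ((n : ℂ) ^ 2 - v ^ 2)) *
        cosPartialFracLim b (Complex.I * n) =
      ((Real.pi * Real.sqrt 3 / 6 : ℝ) : ℂ) *
        ∑' n : ℕ, ((oddSign a n / coshDenom n : ℝ) : ℂ) * ((n : ℂ) / ((n : ℂ) ^ 2 - v ^ 2)) := by
    intro a b ha hb hab v
    rw [← tsum_mul_left]
    refine tsum_congr fun n => ?_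
    rw [← mul_assoc, ← oddSign_mul_cosPartialFracLim ha hb hab n]
    simp only [Complex.real_smul]
    ring
  rw [t h1 h2 rfl, t h2 h1 rfl, ← mul_add, cosPartialFracLim_eq h1, cosPartialFracLim_eq h2] at key
  have m1 := add_natCast_mem_of_norm_lt_one h1 hw
  have m2 := add_natCast_mem_of_norm_lt_one h2 (w := Complex.I * w) (by simpa using hw)
  have n1 := cos_sub_cos_ne_zero m1.1 m1.2
  have n2 := cos_sub_cos_ne_zero m2.1 m2.2
  have c1 := two_mul_cos_pi_mul_div_three h1
  have c2 := two_mul_cos_pi_mul_div_three h2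
  have r1 : Complex.cos (Real.pi * w / 3) = Complex.cos (Real.pi / 3 * w) := by congr 1; ring
  have r2 : Complex.cos (Real.pi * (Complex.I * w) / 3) = Complex.cosh (Real.pi / 3 * w) := by
    rw [← Complex.cos_mul_I]; congr 1; ring
  rw [r1] at n1 key
  rw [r2] at n2 key
  rw [pow_one, ← sub_eq_add_neg, neg_one_sq] at key
  rw [pow_one, neg_neg] at c1
  rw [neg_one_sq] at c2
  have n1' : 2 * Complex.cos (Real.pi / 3 * w) - 1 ≠ 0 := fun h => n1 (by
    linear_combination (h - c1) / 2)
  have n2' : 2 * Complex.cosh (Real.pi / 3 * w) + 1 ≠ 0 := fun h => n2 (by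
    linear_combination (h - c2) / 2)
  -- The constant `π √3 / 6` occurs twice in the product of the expansions and once in the resulting
  -- sums; one copy is cancelled.
  apply mul_left_cancel₀ hc
  rw [← mul_assoc, ← key]
  generalize Complex.cos (Real.pi / 3 * w) = u at n1' ⊢
  generalize Complex.cosh (Real.pi / 3 * w) = v at n2' ⊢
  field_simp

/-! ### Comparison of coefficients -/

/-- The product of the exponential generating function of the generalized Bernoulli numbers of
`chiThree` at `z` and that of its Euler numbers at `i z`. -/
def bernoulliEulerSeries : PowerSeries ℂ :=
  (mk fun m => bernoulliChar chiThree m 0 / (m ! : ℂ)) *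
    rescale Complex.I (mk fun m => eulerChar chiThree m 0 / (m ! : ℂ))

/-- Up to a constant, `invCoshCosSeries` inverts the rescaled `coshCosProd`, so multiplying by it
isolates the Bernoulli–Euler product. The factor `2 X` shifts the index by one. -/
theorem pow_mul_coeff_bernoulliChar_mul_eulerChar (p : ℕ) :
    (Real.pi / 3 : ℂ) ^ (p + 1) * coeff (p + 1) bernoulliEulerSeries *
      ((Real.pi * Real.sqrt 3 / 6 : ℝ) : ℂ) = 2 * (Real.pi / 3) * coeff p invCoshCosSeries := by
  have h := congrArg (rescale (Real.pi / 3 : ℂ)) bernoulliChar_mul_eulerChar_mul_coshCosProd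
  rw [← bernoulliEulerSeries, map_mul, map_mul, rescale_X, map_ofNat] at h
  have h2 : rescale (Real.pi / 3 : ℂ) bernoulliEulerSeries * C ((Real.pi * Real.sqrt 3 / 6 : ℝ) : ℂ) =
      C (2 * (Real.pi / 3) : ℂ) * (invCoshCosSeries * X) := by
    rw [← invCoshCosSeries_mul, map_mul C, map_ofNat]
    linear_combination invCoshCosSeries * h
  have h3 := congrArg (coeff (p + 1)) h2
  rwa [coeff_mul_C, coeff_rescale, coeff_C_mul, coeff_succ_mul_X] at h3

theorem factorial_mul_coeff_bernoulliChar_mul_eulerChar (p : ℕ) :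
    (p ! : ℂ) * coeff p bernoulliEulerSeries =
    ∑ m ∈ Icc 1 p, (Nat.choose p m : ℂ) * Complex.I ^ (p - m) *
      eulerChar chiThree (p - m) 0 * bernoulliChar chiThree m 0 := by
  rw [bernoulliEulerSeries, coeff_mul, Nat.sum_antidiagonal_eq_sum_range_succ_mk, mul_sum]
  -- The `m = 0` term drops out, so the sum starts at `m = 1`.
  have h0 : bernoulliChar chiThree 0 0 = 0 := by
    simp [bernoulliChar_chiThree]
  rw [range_eq_Ico, sum_eq_sum_Ico_succ_bot (Nat.succ_pos p)]
  have hI : Ico (0 + 1) p.succ = Icc 1 p := by ext; simp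
  rw [hI]
  simp only [coeff_mk, h0, zero_div, zero_mul, mul_zero, zero_add, coeff_rescale]
  refine sum_congr rfl fun m hm => ?_
  rw [Nat.cast_choose ℂ (mem_Icc.1 hm).2]
  have := Nat.factorial_ne_zero m
  have := Nat.factorial_ne_zero (p - m)
  field_simp

end PowerSeries

/-! ### Recovering the character series -/

theorem eulerPoly_zero (x : ℝ) : eulerPoly 0 x = 1 := by
  have h : PowerSeries.constantCoeff (2 : PowerSeries ℝ) = 2 := map_ofNat _ 2
  have h1 : PowerSeries.constantCoeff (PowerSeries.rescale x (PowerSeries.exp ℝ)) = 1 := by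
    rw [← PowerSeries.coeff_zero_eq_constantCoeff_apply, PowerSeries.coeff_rescale]; simp
  rw [eulerPoly, PowerSeries.coeff_zero_eq_constantCoeff_apply, map_mul, map_mul,
    PowerSeries.constantCoeff_inv, h, h1]
  norm_num

theorem chiThree_eq_oddSign (n : ℕ) :
    chiThree (n : ZMod 3) = ((oddSign 1 n - oddSign 2 n : ℝ) : ℂ) := by
  have h := chiThree_apply n
  rw [Int.cast_natCast] at h
  rw [h, oddSign, oddSign]
  have : n % 6 < 6 := Nat.mod_lt _ (by norm_num)
  have h3 : (n : ℤ) % 3 = ((n % 6 : ℕ) : ℤ) % 3 := by omega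
  rw [h3]
  generalize n % 6 = r at *
  interval_cases r <;> norm_num

theorem oddSign_one_mul_neg_one_pow (n q : ℕ) :
    (-1 : ℝ) ^ (n * q) * oddSign 1 n = (-1) ^ q * oddSign 1 n := by
  unfold oddSign
  rcases Nat.even_or_odd n with hn | hn
  · rw [Nat.even_iff] at hn
    rw [if_neg (by omega), if_neg (by omega)]; simp
  · rw [pow_mul, hn.neg_one_pow]

theorem oddSign_two_mul_neg_one_pow (n q : ℕ) :
    (-1 : ℝ) ^ (n * q) * oddSign 2 n = oddSign 2 n := by
  unfold oddSign
  rcases Nat.even_or_odd n with hn | hn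
  · rw [pow_mul, hn.neg_one_pow, one_pow, one_mul]
  · rw [Nat.odd_iff] at hn
    rw [if_neg (by omega), if_neg (by omega)]; simp

/-- The sign `(-1) ^ (n (j + 1))` is `(-1) ^ (j + 1)` on the odd support of `oddSign 1` and `1` on
the even support of `oddSign 2`. In the power series the second part carries `i ^ (2 j) = (-1) ^ j`,
which gives the same relative sign. -/
theorem hasSum_chiThree_div_coshDenom (j : ℕ) :
    HasSum (fun n : ℕ+ => (-1 : ℂ) ^ ((n : ℕ) * (j + 1)) * (chiThree ((n : ℕ) : ZMod 3) /
        (((n : ℕ) : ℂ) ^ (2 * j + 1) * (coshDenom n : ℂ))))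
      ((-1) ^ (j + 1) * PowerSeries.coeff (2 * j) PowerSeries.invCoshCosSeries) := by
  have hs : ∀ a, HasSum (fun n : ℕ => ((oddSign a n / coshDenom n / (n : ℝ) ^ (2 * j + 1) : ℝ) : ℂ))
      (invCoshCoeff a (2 * j)) := fun a => by
    have h := Complex.hasSum_ofReal.2 (summable_oddSign_div_coshDenom a (2 * j)).hasSum
    rw [Complex.ofReal_tsum] at h
    rw [invCoshCoeff]
    simpa [pow_mul] using h
  have h := ((hs 1).mul_left ((-1 : ℂ) ^ (j + 1))).sub (hs 2)
  have hv : (-1 : ℂ) ^ (j + 1) * invCoshCoeff 1 (2 * j) - invCoshCoeff 2 (2 * j) =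
      (-1) ^ (j + 1) * PowerSeries.coeff (2 * j) PowerSeries.invCoshCosSeries := by
    rw [PowerSeries.invCoshCosSeries, map_add, PowerSeries.coeff_rescale, PowerSeries.coeff_mk,
      PowerSeries.coeff_mk, pow_mul Complex.I, Complex.I_sq, mul_add, ← mul_assoc, ← pow_add,
      Odd.neg_one_pow (n := j + 1 + j) ⟨j, by ring⟩]
    ring
  rw [hv] at h
  rw [← PNat.coe_injective.hasSum_iff (fun n hn => ?_)] at h
  · convert! h using 2 with n
    have e1 := congrArg Complex.ofReal (oddSign_one_mul_neg_one_pow n (j + 1))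
    have e2 := congrArg Complex.ofReal (oddSign_two_mul_neg_one_pow n (j + 1))
    push_cast at e1 e2
    rw [chiThree_eq_oddSign]
    simp only [Function.comp_apply]
    push_cast
    rw [← mul_div_assoc, mul_sub, e1, e2]
    rw [div_div, div_div, mul_comm ((coshDenom n : ℝ) : ℂ)]
    ring
  · have : n = 0 := by
      by_contra h0
      exact hn ⟨⟨n, Nat.pos_of_ne_zero h0⟩, rfl⟩
    subst this
    simp

theorem hasSum_chiThree_div_cosh (p : ℕ) (hp : Odd p) :
    HasSum
      (fun n : ℕ+ =>
        (-1 : ℂ) ^ ((n : ℕ) * ((p + 1) / 2)) *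
          (chiThree ((n : ℕ) : ZMod 3) /
            (((n : ℕ) : ℂ) ^ p *
              (2 * ((Real.cosh (((n : ℕ) : ℝ) * Real.pi / 3) : ℝ) : ℂ) - (-1 : ℂ) ^ (n : ℕ)))))
      ((-1 : ℂ) ^ ((p + 1) / 2) / (4 * ((Real.sqrt 3 : ℝ) : ℂ)) * (3 / (Nat.factorial p : ℂ)) *
        ((Real.pi : ℂ) / 3) ^ p *
        ∑ m ∈ Finset.Icc 1 p,
          (Nat.choose p m : ℂ) * Complex.I ^ (p - m) *
            eulerChar chiThree (p - m) 0 * bernoulliChar chiThree m 0) := by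
  obtain ⟨j, rfl⟩ := hp
  have hj : (2 * j + 1 + 1) / 2 = j + 1 := by omega
  rw [hj, ← PowerSeries.factorial_mul_coeff_bernoulliChar_mul_eulerChar]
  have h1 := PowerSeries.pow_mul_coeff_bernoulliChar_mul_eulerChar (2 * j)
  have h2 := hasSum_chiThree_div_coshDenom j
  convert! h2 using 1
  · ext n
    simp [coshDenom]
  · generalize PowerSeries.coeff (2 * j + 1) PowerSeries.bernoulliEulerSeries = W at h1 ⊢
    have hf : ((2 * j + 1)! : ℂ) ≠ 0 := by exact_mod_cast Nat.factorial_ne_zero _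
    have hs : ((Real.sqrt 3 : ℝ) : ℂ) ≠ 0 := by simp
    have hs2 : ((Real.sqrt 3 : ℝ) : ℂ) ^ 2 = 3 := by
      rw [← Complex.ofReal_pow, Real.sq_sqrt (by norm_num)]; norm_num
    have hpi : (Real.pi : ℂ) ≠ 0 := by exact_mod_cast Real.pi_ne_zero
    have h3 : PowerSeries.coeff (2 * j) PowerSeries.invCoshCosSeries =
        (Real.pi / 3 : ℂ) ^ (2 * j + 1) * W * (Real.sqrt 3 : ℝ) / 4 := by
      push_cast at h1
      apply mul_left_cancel₀ (mul_ne_zero two_ne_zero (div_ne_zero hpi three_ne_zero))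
      rw [← h1]; ring
    rw [h3, ← hs2]
    field_simp

end

theorem mainTheorem11 :
    (∀ p : ℕ, Odd p →
      HasSum
        (fun n : ℕ+ =>
          (-1 : ℂ) ^ ((n : ℕ) * ((p + 1) / 2)) *
            (chiThree ((n : ℕ) : ZMod 3) /
              (((n : ℕ) : ℂ) ^ p *
                (2 * ((Real.cosh (((n : ℕ) : ℝ) * Real.pi / 3) : ℝ) : ℂ) - (-1 : ℂ) ^ (n : ℕ)))))
        ((-1 : ℂ) ^ ((p + 1) / 2) / (4 * ((Real.sqrt 3 : ℝ) : ℂ)) * (3 / (Nat.factorial p : ℂ)) *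
          ((Real.pi : ℂ) / 3) ^ p *
          ∑ m ∈ Finset.Icc 1 p,
            (Nat.choose p m : ℂ) * Complex.I ^ (p - m) *
              eulerChar chiThree (p - m) 0 * bernoulliChar chiThree m 0)) ∧
    (HasSum
        (fun n : ℕ+ =>
          ((-1 : ℂ) ^ (n : ℕ) * chiThree ((n : ℕ) : ZMod 3)) /
            (((n : ℕ) : ℂ) *
              (2 * ((Real.cosh (((n : ℕ) : ℝ) * Real.pi / 3) : ℝ) : ℂ) - (-1 : ℂ) ^ (n : ℕ))))
        (-((Real.pi : ℂ) / (4 * ((Real.sqrt 3 : ℝ) : ℂ))) *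
          eulerChar chiThree 0 0 * bernoulliChar chiThree 1 0) ∧
      -((Real.pi : ℂ) / (4 * ((Real.sqrt 3 : ℝ) : ℂ))) *
          eulerChar chiThree 0 0 * bernoulliChar chiThree 1 0 =
        -((Real.pi : ℂ) / (6 * ((Real.sqrt 3 : ℝ) : ℂ)))) ∧
    HasSum
      (fun n : ℕ+ =>
        chiThree ((n : ℕ) : ZMod 3) /
          (((n : ℕ) : ℂ) ^ 3 *
            (2 * ((Real.cosh (((n : ℕ) : ℝ) * Real.pi / 3) : ℝ) : ℂ) - (-1 : ℂ) ^ (n : ℕ))))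
      (((Real.pi : ℂ) / 3) ^ 3 / (8 * ((Real.sqrt 3 : ℝ) : ℂ)) *
        (eulerChar chiThree 0 0 * bernoulliChar chiThree 3 0 -
          3 * eulerChar chiThree 2 0 * bernoulliChar chiThree 1 0)) := by
  have h0 : eulerChar chiThree 0 0 = -2 := by
    rw [eulerChar_chiThree, eulerPoly_zero, eulerPoly_zero]; norm_num
  have h1 : bernoulliChar chiThree 1 0 = -1 / 3 := by
    simp [bernoulliChar_chiThree, bernoulliFun_one]; norm_num
  -- By the symmetry of `B_2` under `x ↦ 1 - x`, the `m = 2` term is absent from the case `p = 3`.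
  have h2 : bernoulliChar chiThree 2 0 = 0 := by
    rw [bernoulliChar_chiThree, bernoulliFun_two, bernoulliFun_two]; norm_num
  refine ⟨hasSum_chiThree_div_cosh, ⟨?_, ?_⟩, ?_⟩
  · convert! hasSum_chiThree_div_cosh 1 odd_one using 1
    · ext n
      simp [mul_div_assoc]
    · simp
      ring
  · rw [h0, h1]
    ring
  · convert! hasSum_chiThree_div_cosh 3 (by decide) using 1
    · ext n
      have h : ((-1 : ℂ) ^ (n : ℕ)) ^ 2 = 1 := by rw [← pow_mul, mul_comm, pow_mul]; simp
      simp [pow_mul, h]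
    · rw [show Finset.Icc 1 3 = {1, 2, 3} by decide]
      simp [h2, Nat.factorial]
      ring
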